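/- Let $d\ge 1$, let $\Omega\subseteq\mathbb{R}^d$ be open and bounded, and let all function spaces be complex, with scalar products anti-linear in the first and linear in the second component. Let $H_0^1(\Omega)$ be the closure of $C_c^\infty(\Omega)$ in $H^1(\Omega)$, $H^{-1}(\Omega):=H_0^1(\Omega)^*$, $g_0(\Omega):=\operatorname{grad}[H_0^1(\Omega)]$, which is a closed subspace of $L_2(\Omega)^d$, and let $\iota_0\colon g_0(\Omega)\hookrightarrow L_2(\Omega)^d$ be the canonical embedding, so that $\iota_0^*$ is the orthogonal projection onto $g_0(\Omega)$. Matrix functions in $L_\infty(\Omega)^{d\times d}$ are identified with the induced multiplication operators on $L_2(\Omega)^d$. For $\tilde a\in L_\infty(\Omega)^{d\times d}$, $f\in H^{-1}(\Omega)$ and $u\in H_0^1(\Omega)$, the equation $-\operatorname{div}\tilde a\operatorname{grad}u=f$ means $\langle \tilde a\operatorname{grad}u,\operatorname{grad}\varphi\rangle=f(\varphi)$ for all $\varphi\in H_0^1(\Omega)$. **Holomorphic $G$-convergence.** Let $H$ be a complex Hilbert space, $(a_n)_n$ a sequence in $L(H)$ and $a\subseteq H\times H$ a relation. We say that $(a_n)_n$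 holomorphically $G$-converges to $a$ if there is an open set $\omega\subseteq\bigcap_n\rho(a_n)\subseteq\mathbb{C}$ with $0\in\overline\omega$ such that $\sup_n\sup_{\lambda\in K}\|(a_n-\lambda)^{-1}\|<\infty$ for every compact $K\subseteq\omega$, and such that the following holds. Let $\mathcal G$ be the set of all $\phi\in H$ for which (a) there is a holomorphic $f_\phi\colon\omega\to H$ such that, for every $\psi\in H$, $\langle\psi,(a_n-\cdot)^{-1}\phi\rangle\to\langle\psi,f_\phi(\cdot)\rangle$ uniformly on compact subsets of $\omega$, and (b) $f_\phi$ admits a holomorphic extension to (a neighbourhood of) $0$. Then $\mathcal G$ is dense in $H$ and $a^{-1}=\{(\phi,\psi)\in\mathcal G\times H:\ \psi=f_\phi(0)\}$. An operator is identified with its graph. **Theorem 2.4.** Let $\tilde a\in L_\infty(\Omega)^{d\times d}$, let $(\tilde a_n)_n$ be a sequence in $L_\infty(\Omega)^{d\times d}$, and put $a_n:=\iota_0^*\tilde a_n\iota_0$ and $a:=\iota_0^*\tilde a\iota_0$ in $L(g_0(\Omega))$. Assume $0\in\rho(a)\cap\bigcap_{n}\rho(a_n)$ and $\sup_n\|a_n^{-1}\|<\infty$.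 Consider the following assertions: (i) $(a_n)_n$ holomorphically $G$-converges to $a$; (ii) every subsequence of $(a_n)_n$ has a further subsequence that holomorphically $G$-converges to $a$; (iii) $(\tilde a_n)_n$ $G$-converges to $\tilde a$, i.e. whenever $f\in H^{-1}(\Omega)$ and $u_n\in H_0^1(\Omega)$ satisfy $-\operatorname{div}\tilde a_n\operatorname{grad}u_n=f$ for all $n$, there is $u\in H_0^1(\Omega)$ with $u_n\rightharpoonup u$ weakly in $H_0^1(\Omega)$ and $-\operatorname{div}\tilde a\operatorname{grad}u=f$. Then (i)$\Rightarrow$(iii)$\Leftrightarrow$(ii). -/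

import Mathlib

open MeasureTheory Filter Topology TopologicalSpace
open scoped ENNReal InnerProductSpace Distributions

namespace HolG

noncomputable section

/-! ### Holomorphic `G`-convergence in a complex Hilbert space -/

section Abstract

variable {H : Type*} [NormedAddCommGroup H] [InnerProductSpace ℂ H]

/-- `(a - z)⁻¹`; this is the true inverse for `z` in the resolvent set of `a`. -/
def shiftInv (a : H →L[ℂ] H) (z : ℂ) : H →L[ℂ] H :=
  Ring.inverse (a - algebraMap ℂ (H →L[ℂ] H) z)

/-- `f : ω → H` is holomorphic and, for every `ψ`, `⟨ψ, (aₙ - ·)⁻¹ φ⟩ → ⟨ψ, f(·)⟩` uniformly on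
compact subsets of `ω`. -/
def IsResolventLimit (a : ℕ → H →L[ℂ] H) (ω : Set ℂ) (φ : H) (f : ℂ → H) : Prop :=
  DifferentiableOn ℂ f ω ∧
    ∀ ψ : H, ∀ K : Set ℂ, K ⊆ ω → IsCompact K →
      TendstoUniformlyOn (fun n z => ⟪ψ, shiftInv (a n) z φ⟫_ℂ) (fun z => ⟪ψ, f z⟫_ℂ) atTop K

/-- `f : ω → H` admits a holomorphic extension to (a neighbourhood of) `0`, with value `v` at
`0`. -/
def ExtendsToZero (f : ℂ → H) (ω : Set ℂ) (v : H) : Prop :=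
  ∃ (U : Set ℂ) (F : ℂ → H), IsOpen U ∧ 0 ∈ U ∧ DifferentiableOn ℂ F U ∧
    Set.EqOn F f (U ∩ ω) ∧ F 0 = v

/-- The set `𝒢` of all `φ` for which the resolvents applied to `φ` have a limit on `ω` that extends
holomorphically to `0`. -/
def goodSet (a : ℕ → H →L[ℂ] H) (ω : Set ℂ) : Set H :=
  {φ | ∃ f v, IsResolventLimit a ω φ f ∧ ExtendsToZero f ω v}

/-- The relation `{(φ, ψ) ∈ 𝒢 × H; ψ = f_φ(0)}`. -/
def limitInverse (a : ℕ → H →L[ℂ] H) (ω : Set ℂ) : SetRel H H :=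
  {p | ∃ f, IsResolventLimit a ω p.1 f ∧ ExtendsToZero f ω p.2}

/-- `(aₙ)` holomorphically `G`-converges on `ω` to the relation `a ⊆ H × H`. -/
structure HolGConvergesOn (a : ℕ → H →L[ℂ] H) (ω : Set ℂ) (aLim : SetRel H H) : Prop where
  isOpen : IsOpen ω
  subset_resolventSet : ∀ n, ω ⊆ resolventSet ℂ (a n)
  zero_mem_closure : (0 : ℂ) ∈ closure ω
  locallyBounded : ∀ K : Set ℂ, K ⊆ ω → IsCompact K →
    ∃ C : ℝ, ∀ n, ∀ z ∈ K, ‖shiftInv (a n) z‖ ≤ C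
  dense : Dense (goodSet a ω)
  inv_eq : aLim.inv = limitInverse a ω

/-- `(aₙ)` holomorphically `G`-converges to the relation `a ⊆ H × H`. -/
def HolGConverges (a : ℕ → H →L[ℂ] H) (aLim : SetRel H H) : Prop :=
  ∃ ω : Set ℂ, HolGConvergesOn a ω aLim

end Abstract

/-! ### Sobolev spaces on an open set `Ω ⊆ ℝᵈ` -/

variable {d : ℕ}

/-- `L₂(Ω)`, complex-valued. -/
abbrev L2 (Ω : Opens (EuclideanSpace ℝ (Fin d))) : Type :=
  Lp ℂ 2 (volume.restrict (Ω : Set (EuclideanSpace ℝ (Fin d))))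

/-- `L₂(Ω)ᵈ` with its Hilbert space norm. -/
abbrev L2Vec (Ω : Opens (EuclideanSpace ℝ (Fin d))) : Type :=
  PiLp 2 (fun _ : Fin d => L2 Ω)

/-- The `i`-th partial derivative. -/
def partialDeriv (i : Fin d) (φ : EuclideanSpace ℝ (Fin d) → ℂ)
    (x : EuclideanSpace ℝ (Fin d)) : ℂ :=
  fderiv ℝ φ x (EuclideanSpace.single i 1)

/-- `H¹(Ω)`, realised as the space of all pairs `(u, ∇u) ∈ L₂(Ω) × L₂(Ω)ᵈ` with `∇u` the weak
gradient of `u`; the norm is `(‖u‖² + ‖∇u‖²)^{1/2}`. -/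
def H1 (Ω : Opens (EuclideanSpace ℝ (Fin d))) : Set (WithLp 2 (L2 Ω × L2Vec Ω)) :=
  {p | ∀ (φ : 𝓓(Ω, ℂ)) (i : Fin d),
    ∫ x in (Ω : Set (EuclideanSpace ℝ (Fin d))), p.fst x * partialDeriv i φ x
      = - ∫ x in (Ω : Set (EuclideanSpace ℝ (Fin d))), p.snd i x * φ x}

/-- The pair `p ∈ L₂(Ω) × L₂(Ω)ᵈ` is `(φ, ∇φ)`. -/
def IsTestPair {Ω : Opens (EuclideanSpace ℝ (Fin d))} (φ : 𝓓(Ω, ℂ))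
    (p : WithLp 2 (L2 Ω × L2Vec Ω)) : Prop :=
  p.fst =ᵐ[volume.restrict (Ω : Set (EuclideanSpace ℝ (Fin d)))] φ ∧
    ∀ i, p.snd i =ᵐ[volume.restrict (Ω : Set (EuclideanSpace ℝ (Fin d)))] partialDeriv i φ

lemma partialDeriv_add {Ω : Opens (EuclideanSpace ℝ (Fin d))} (φ ψ : 𝓓(Ω, ℂ)) (i : Fin d) :
    partialDeriv i (⇑(φ + ψ)) = partialDeriv i φ + partialDeriv i ψ := by
  funext x
  have h1 : DifferentiableAt ℝ φ x := (φ.contDiff.differentiable (by simp)) x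
  have h2 : DifferentiableAt ℝ ψ x := (ψ.contDiff.differentiable (by simp)) x
  have : (⇑(φ + ψ) : _ → ℂ) = ⇑φ + ⇑ψ := rfl
  simp only [partialDeriv, this, fderiv_add h1 h2, Pi.add_apply, add_apply]

lemma partialDeriv_smul {Ω : Opens (EuclideanSpace ℝ (Fin d))} (c : ℂ) (φ : 𝓓(Ω, ℂ))
    (i : Fin d) : partialDeriv i (⇑(c • φ)) = c • partialDeriv i φ := by
  funext x
  have h1 : DifferentiableAt ℝ φ x := (φ.contDiff.differentiable (by simp)) x
  have : (⇑(c • φ) : _ → ℂ) = c • ⇑φ := rfl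
  simp only [partialDeriv, this, fderiv_const_smul h1 c, Pi.smul_apply, smul_apply]

/-- The image of `C_c^∞(Ω)` in `L₂(Ω) × L₂(Ω)ᵈ` under `φ ↦ (φ, ∇φ)`. -/
def testPairs (Ω : Opens (EuclideanSpace ℝ (Fin d))) :
    Submodule ℂ (WithLp 2 (L2 Ω × L2Vec Ω)) where
  carrier := {p | ∃ φ : 𝓓(Ω, ℂ), IsTestPair φ p}
  zero_mem' := by
    refine ⟨0, ?_, fun i => ?_⟩
    · exact Lp.coeFn_zero ℂ 2 _
    · have : partialDeriv i (⇑(0 : 𝓓(Ω, ℂ))) = 0 := by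
        funext x
        have h : (⇑(0 : 𝓓(Ω, ℂ)) : _ → ℂ) = 0 := rfl
        simp [partialDeriv, h]
      rw [this]
      exact Lp.coeFn_zero ℂ 2 _
  add_mem' := by
    rintro p q ⟨φ, h1, h2⟩ ⟨ψ, h3, h4⟩
    refine ⟨φ + ψ, ?_, fun i => ?_⟩
    · exact (Lp.coeFn_add p.fst q.fst).trans (h1.add h3)
    · rw [partialDeriv_add]
      exact (Lp.coeFn_add (p.snd i) (q.snd i)).trans ((h2 i).add (h4 i))
  smul_mem' := by
    rintro c p ⟨φ, h1, h2⟩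
    refine ⟨c • φ, ?_, fun i => ?_⟩
    · exact (Lp.coeFn_smul c p.fst).trans (h1.const_smul c)
    · rw [partialDeriv_smul]
      exact (Lp.coeFn_smul c (p.snd i)).trans ((h2 i).const_smul c)

/-- `H₀¹(Ω)`: the closure of `C_c^∞(Ω)` in the norm of `H¹(Ω)`. An element is a pair `(u, ∇u)`; see
`H10_subset_H1`. -/
def H10 (Ω : Opens (EuclideanSpace ℝ (Fin d))) : Submodule ℂ (WithLp 2 (L2 Ω × L2Vec Ω)) :=
  (testPairs Ω).topologicalClosure

/-- The gradient `H₀¹(Ω) → L₂(Ω)ᵈ`. -/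
def grad (Ω : Opens (EuclideanSpace ℝ (Fin d))) : H10 Ω →L[ℂ] L2Vec Ω :=
  (WithLp.sndL 2 ℂ (L2 Ω) (L2Vec Ω)) ∘L (H10 Ω).subtypeL

/-- `g₀(Ω) = grad[H₀¹(Ω)] ⊆ L₂(Ω)ᵈ`. -/
def g0 (Ω : Opens (EuclideanSpace ℝ (Fin d))) : Submodule ℂ (L2Vec Ω) :=
  LinearMap.range (grad Ω : H10 Ω →ₗ[ℂ] L2Vec Ω)

/-! ### `H₀¹(Ω) ⊆ H¹(Ω)`, Poincaré's inequality, and closedness of `g₀(Ω)` -/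

lemma continuous_partialDeriv {Ω : Opens (EuclideanSpace ℝ (Fin d))} (φ : 𝓓(Ω, ℂ)) (i : Fin d) :
    Continuous (partialDeriv i φ) :=
  (φ.contDiff.continuous_fderiv (by simp)).clm_apply continuous_const

lemma hasCompactSupport_partialDeriv {Ω : Opens (EuclideanSpace ℝ (Fin d))} (φ : 𝓓(Ω, ℂ))
    (i : Fin d) : HasCompactSupport (partialDeriv i φ) :=
  (φ.hasCompactSupport.fderiv ℝ).mono (fun x hx => by
    intro h; apply hx; simp [partialDeriv, h])

lemma partialDeriv_eq_zero {Ω : Opens (EuclideanSpace ℝ (Fin d))} (φ : 𝓓(Ω, ℂ)) (i : Fin d)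
    {x : EuclideanSpace ℝ (Fin d)} (hx : x ∉ Ω) : partialDeriv i φ x = 0 := by
  have h : x ∉ tsupport (fderiv ℝ φ) := fun h =>
    hx (φ.tsupport_subset (tsupport_fderiv_subset ℝ h))
  simp [partialDeriv, image_eq_zero_of_notMem_tsupport h]

lemma testFun_eq_zero {Ω : Opens (EuclideanSpace ℝ (Fin d))} (φ : 𝓓(Ω, ℂ))
    {x : EuclideanSpace ℝ (Fin d)} (hx : x ∉ Ω) : φ x = 0 :=
  image_eq_zero_of_notMem_tsupport (fun h => hx (φ.tsupport_subset h))

lemma testPairs_subset_H1 (Ω : Opens (EuclideanSpace ℝ (Fin d))) :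
    (testPairs Ω : Set (WithLp 2 (L2 Ω × L2Vec Ω))) ⊆ H1 Ω := by
  rintro p ⟨ψ, h1, h2⟩ φ i
  have e1 : ∫ x in (Ω : Set (EuclideanSpace ℝ (Fin d))), p.fst x * partialDeriv i φ x
      = ∫ x, ψ x * partialDeriv i φ x := by
    rw [← setIntegral_eq_integral_of_forall_compl_eq_zero
      (s := (Ω : Set (EuclideanSpace ℝ (Fin d))))
      (f := fun x => ψ x * partialDeriv i φ x)
      (fun x hx => by rw [testFun_eq_zero ψ hx, zero_mul])]
    exact integral_congr_ae (h1.mul (ae_eq_refl (partialDeriv i φ)))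
  have e2 : ∫ x in (Ω : Set (EuclideanSpace ℝ (Fin d))), p.snd i x * φ x
      = ∫ x, partialDeriv i ψ x * φ x := by
    rw [← setIntegral_eq_integral_of_forall_compl_eq_zero
      (s := (Ω : Set (EuclideanSpace ℝ (Fin d))))
      (f := fun x => partialDeriv i ψ x * φ x)
      (fun x hx => by rw [testFun_eq_zero φ hx, mul_zero])]
    exact integral_congr_ae ((h2 i).mul (ae_eq_refl (φ : _ → ℂ)))
  rw [e1, e2]
  exact integral_mul_fderiv_eq_neg_fderiv_mul_of_integrable
    (((continuous_partialDeriv ψ i).mul φ.continuous).integrable_of_hasCompactSupport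
      φ.hasCompactSupport.mul_left)
    ((ψ.continuous.mul (continuous_partialDeriv φ i)).integrable_of_hasCompactSupport
      (hasCompactSupport_partialDeriv φ i).mul_left)
    ((ψ.continuous.mul φ.continuous).integrable_of_hasCompactSupport
      φ.hasCompactSupport.mul_left)
    (fun x _ => ψ.contDiff.differentiable (by simp) x)
    (fun x _ => φ.contDiff.differentiable (by simp) x)

lemma continuous_setIntegral_mul {Ω : Opens (EuclideanSpace ℝ (Fin d))}
    {h : EuclideanSpace ℝ (Fin d) → ℂ} (hc : Continuous h) (hs : HasCompactSupport h) :
    Continuous (fun u : L2 Ω => ∫ x in (Ω : Set (EuclideanSpace ℝ (Fin d))), u x * h x) := by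
  have hm : MemLp (fun x => star (h x)) 2
      (volume.restrict (Ω : Set (EuclideanSpace ℝ (Fin d)))) :=
    ((hc.star).memLp_of_hasCompactSupport (hs.comp_left (g := star) (star_zero ℂ)))
  have : (fun u : L2 Ω => ∫ x in (Ω : Set (EuclideanSpace ℝ (Fin d))), u x * h x)
      = fun u : L2 Ω => ⟪(hm.toLp _ : L2 Ω), u⟫_ℂ := by
    funext u
    rw [L2.inner_def]
    refine integral_congr_ae ?_
    filter_upwards [hm.coeFn_toLp] with x hx
    rw [hx]
    simp [RCLike.inner_apply]
  rw [this]
  fun_prop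

/-- The gradient component of an element of `H₀¹(Ω)` is its weak gradient. -/
theorem H10_subset_H1 (Ω : Opens (EuclideanSpace ℝ (Fin d))) :
    (H10 Ω : Set (WithLp 2 (L2 Ω × L2Vec Ω))) ⊆ H1 Ω := by
  have hcl : IsClosed (H1 Ω) := by
    simp only [H1, Set.ofPred_forall]
    refine isClosed_iInter fun φ => isClosed_iInter fun i => isClosed_eq ?_ ?_
    · exact (continuous_setIntegral_mul (continuous_partialDeriv φ i)
        (hasCompactSupport_partialDeriv φ i)).comp (WithLp.fstL 2 ℂ (L2 Ω) (L2Vec Ω)).continuous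
    · exact ((continuous_setIntegral_mul φ.continuous φ.hasCompactSupport).comp
        ((PiLp.proj 2 (𝕜 := ℂ) (fun _ : Fin d => L2 Ω) i).continuous.comp
          (WithLp.sndL 2 ℂ (L2 Ω) (L2Vec Ω)).continuous)).neg
  exact closure_minimal (testPairs_subset_H1 Ω) hcl

lemma norm_sq_eq_integral {Ω : Opens (EuclideanSpace ℝ (Fin d))} (u : L2 Ω)
    (h : EuclideanSpace ℝ (Fin d) → ℂ)
    (hu : u =ᵐ[volume.restrict (Ω : Set (EuclideanSpace ℝ (Fin d)))] h)
    (h0 : ∀ x ∉ Ω, h x = 0) : ‖u‖ ^ 2 = ∫ x, ‖h x‖ ^ 2 := by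
  have e : ((‖u‖ ^ 2 : ℝ) : ℂ) = ((∫ x, ‖h x‖ ^ 2 : ℝ) : ℂ) := by
    have := inner_self_eq_norm_sq_to_K (𝕜 := ℂ) u
    push_cast
    rw [← setIntegral_eq_integral_of_forall_compl_eq_zero
      (s := (Ω : Set (EuclideanSpace ℝ (Fin d)))) (f := fun x => ‖h x‖ ^ 2)
      (fun x hx => by rw [h0 x hx]; simp), ← integral_complex_ofReal]
    refine (this.symm.trans (L2.inner_def u u)).trans (integral_congr_ae ?_)
    filter_upwards [hu] with x hx
    rw [hx, inner_self_eq_norm_sq_to_K]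
    simp
  exact_mod_cast e

lemma poincare_test {Ω : Opens (EuclideanSpace ℝ (Fin d))} (φ : 𝓓(Ω, ℂ)) (i : Fin d) {R : ℝ}
    (hR : ∀ x ∈ Ω, ‖x‖ ≤ R) :
    ∫ x, ‖φ x‖ ^ 2 ≤ 4 * R ^ 2 * ∫ x, ‖partialDeriv i φ x‖ ^ 2 := by
  have hd : Differentiable ℝ φ := φ.contDiff.differentiable (by simp)
  have c1 := φ.continuous
  have c2 := continuous_partialDeriv φ i
  have s1 := φ.hasCompactSupport
  have s2 := hasCompactSupport_partialDeriv φ i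
  have s1' : HasCompactSupport (fun x => ‖φ x‖ ^ 2) :=
    s1.comp_left (g := fun z : ℂ => ‖z‖ ^ 2) (by simp)
  have s2' : HasCompactSupport (fun x => ‖partialDeriv i φ x‖ ^ 2) :=
    s2.comp_left (g := fun z : ℂ => ‖z‖ ^ 2) (by simp)
  have i1 : Integrable (fun x => ‖φ x‖ ^ 2) :=
    (by fun_prop : Continuous (fun x => ‖φ x‖ ^ 2)).integrable_of_hasCompactSupport s1'
  have i2 : Integrable (fun x => ‖partialDeriv i φ x‖ ^ 2) :=
    (by fun_prop : Continuous (fun x => ‖partialDeriv i φ x‖ ^ 2)).integrable_of_hasCompactSupport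
      s2'
  let v : EuclideanSpace ℝ (Fin d) := EuclideanSpace.single i 1
  let ℓ : EuclideanSpace ℝ (Fin d) →L[ℝ] ℝ := EuclideanSpace.proj i
  have hf : ∀ x, fderiv ℝ (fun x => ‖φ x‖ ^ 2) x v = 2 * ⟪φ x, partialDeriv i φ x⟫_ℝ := by
    intro x
    rw [(hd x).hasFDerivAt.norm_sq.fderiv]
    simp [partialDeriv, v]
    ring
  have hℓ : ∀ x, fderiv ℝ (fun x => ℓ x) x v = 1 := by
    intro x
    have : fderiv ℝ (fun x => ℓ x) x = ℓ := ℓ.fderiv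
    rw [this]
    simp [ℓ, v]
  have key := integral_mul_fderiv_eq_neg_fderiv_mul_of_integrable (μ := volume)
    (f := fun x => ‖φ x‖ ^ 2) (g := fun x => ℓ x) (v := v) (𝕜 := ℝ)
    (by
      simp only [hf]
      refine Continuous.integrable_of_hasCompactSupport (by fun_prop) ?_
      refine s1.mono fun x hx h => hx ?_
      simp [h])
    (by simpa only [hℓ, mul_one] using i1)
    (by
      refine Continuous.integrable_of_hasCompactSupport (by fun_prop) ?_
      exact s1'.mul_right)
    (fun x _ => hd.norm_sq ℝ x) (fun x _ => ℓ.differentiable x)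
  simp only [hf, hℓ, mul_one] at key
  have bound : ∫ x, -(2 * ⟪φ x, partialDeriv i φ x⟫_ℝ * ℓ x)
      ≤ ∫ x, (1 / 2 * ‖φ x‖ ^ 2 + 2 * R ^ 2 * ‖partialDeriv i φ x‖ ^ 2) := by
    refine integral_mono ?_ ((i1.const_mul _).add (i2.const_mul _)) fun x => ?_
    · refine Continuous.integrable_of_hasCompactSupport (by fun_prop) ?_
      refine s1.mono fun x hx h => hx ?_
      simp [h]
    · by_cases hx : x ∈ Ω
      · have h1 : |⟪φ x, partialDeriv i φ x⟫_ℝ| ≤ ‖φ x‖ * ‖partialDeriv i φ x‖ :=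
          abs_real_inner_le_norm _ _
        have h2 : |ℓ x| ≤ R := (PiLp.norm_apply_le x i).trans (hR x hx)
        have h3 : |⟪φ x, partialDeriv i φ x⟫_ℝ * ℓ x|
            ≤ ‖φ x‖ * ‖partialDeriv i φ x‖ * R := by
          rw [abs_mul]
          exact mul_le_mul h1 h2 (abs_nonneg _) (by positivity)
        have h4 := neg_abs_le (⟪φ x, partialDeriv i φ x⟫_ℝ * ℓ x)
        change -(2 * ⟪φ x, partialDeriv i φ x⟫_ℝ * ℓ x)
          ≤ 1 / 2 * ‖φ x‖ ^ 2 + 2 * R ^ 2 * ‖partialDeriv i φ x‖ ^ 2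
        nlinarith [sq_nonneg (‖φ x‖ - 2 * R * ‖partialDeriv i φ x‖)]
      · simp [testFun_eq_zero φ hx, partialDeriv_eq_zero φ i hx]
  rw [integral_neg, ← key, integral_add (i1.const_mul _) (i2.const_mul _), integral_const_mul,
    integral_const_mul] at bound
  linarith

/-- Poincaré's inequality. -/
theorem poincare (hd : 0 < d) {Ω : Opens (EuclideanSpace ℝ (Fin d))}
    (hΩ : Bornology.IsBounded (Ω : Set (EuclideanSpace ℝ (Fin d)))) :
    ∃ C : ℝ, 0 ≤ C ∧ ∀ p ∈ H10 Ω, ‖p.fst‖ ≤ C * ‖p.snd‖ := by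
  obtain ⟨R, hR0, hR⟩ := hΩ.exists_pos_norm_le
  refine ⟨2 * R, by positivity, fun p hp => ?_⟩
  have hcl : IsClosed {p : WithLp 2 (L2 Ω × L2Vec Ω) | ‖p.fst‖ ≤ 2 * R * ‖p.snd‖} :=
    isClosed_le ((WithLp.fstL 2 ℂ (L2 Ω) (L2Vec Ω)).continuous.norm)
      (((WithLp.sndL 2 ℂ (L2 Ω) (L2Vec Ω)).continuous.norm).const_mul _)
  refine closure_minimal (fun q hq => ?_) hcl hp
  obtain ⟨φ, h1, h2⟩ := hq
  let i : Fin d := ⟨0, hd⟩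
  have e1 := norm_sq_eq_integral q.fst φ h1 (fun x hx => testFun_eq_zero φ hx)
  have e2 := norm_sq_eq_integral (q.snd i) _ (h2 i) (fun x hx => partialDeriv_eq_zero φ i hx)
  have e3 := poincare_test φ i (R := R) (fun x hx => hR x hx)
  rw [← e1, ← e2] at e3
  have e4 : ‖q.snd i‖ ≤ ‖q.snd‖ := PiLp.norm_apply_le _ i
  have e5 : ‖q.fst‖ ≤ 2 * R * ‖q.snd i‖ :=
    abs_le_of_sq_le_sq' (by nlinarith) (by positivity) |>.2
  exact e5.trans (by gcongr)

/-- `g₀(Ω)` is a closed subspace of `L₂(Ω)ᵈ` for bounded `Ω`. -/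
theorem isClosed_g0 (hd : 0 < d) {Ω : Opens (EuclideanSpace ℝ (Fin d))}
    (hΩ : Bornology.IsBounded (Ω : Set (EuclideanSpace ℝ (Fin d)))) :
    IsClosed (g0 Ω : Set (L2Vec Ω)) := by
  obtain ⟨C, hC, h⟩ := poincare hd hΩ
  have : CompleteSpace (H10 Ω) :=
    (testPairs Ω).isClosed_topologicalClosure.completeSpace_coe
  have ha : AntilipschitzWith ⟨C + 1, by positivity⟩ (grad Ω) := by
    refine ContinuousLinearMap.antilipschitz_of_bound (grad Ω) fun u => ?_
    have h1 : ‖u.1.fst‖ ≤ C * ‖u.1.snd‖ := h u.1 u.2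
    have h2 : ‖u‖ ^ 2 = ‖u.1.fst‖ ^ 2 + ‖u.1.snd‖ ^ 2 := WithLp.prod_norm_sq_eq_of_L2 u.1
    change ‖u‖ ≤ (C + 1) * ‖u.1.snd‖
    have h3 := norm_nonneg u.1.snd
    have h4 := norm_nonneg u.1.fst
    refine abs_le_of_sq_le_sq' ?_ (by positivity) |>.2
    rw [h2]
    nlinarith [mul_nonneg hC (sq_nonneg ‖u.1.snd‖)]
  have := ha.isClosed_range (grad Ω).uniformContinuous
  rwa [g0, LinearMap.coe_range]

theorem hasOrthogonalProjection_g0 (hd : 0 < d) {Ω : Opens (EuclideanSpace ℝ (Fin d))}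
    (hΩ : Bornology.IsBounded (Ω : Set (EuclideanSpace ℝ (Fin d)))) :
    (g0 Ω).HasOrthogonalProjection :=
  have : CompleteSpace (g0 Ω) := (isClosed_g0 hd hΩ).completeSpace_coe
  inferInstance

/-! ### Coefficients and divergence form problems -/

/-- `L_∞(Ω)^{d × d}`, complex-valued. -/
abbrev Coeff (Ω : Opens (EuclideanSpace ℝ (Fin d))) : Type :=
  Matrix (Fin d) (Fin d) (Lp ℂ ∞ (volume.restrict (Ω : Set (EuclideanSpace ℝ (Fin d)))))

/-- Multiplication by a function in `L_∞(Ω)`, as an operator on `L₂(Ω)`. -/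
def mulOp {Ω : Opens (EuclideanSpace ℝ (Fin d))}
    (g : Lp ℂ ∞ (volume.restrict (Ω : Set (EuclideanSpace ℝ (Fin d))))) : L2 Ω →L[ℂ] L2 Ω :=
  (ContinuousLinearMap.mul ℂ ℂ).holderL
    (volume.restrict (Ω : Set (EuclideanSpace ℝ (Fin d)))) ∞ 2 2 g

/-- The multiplication operator `q ↦ (∑ⱼ aᵢⱼ qⱼ)ᵢ` on `L₂(Ω)ᵈ` induced by `a`. -/
def coeffOp {Ω : Opens (EuclideanSpace ℝ (Fin d))} (a : Coeff Ω) : L2Vec Ω →L[ℂ] L2Vec Ω :=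
  (PiLp.continuousLinearEquiv 2 ℂ (fun _ : Fin d => L2 Ω)).symm.toContinuousLinearMap ∘L
    ContinuousLinearMap.pi fun i => ∑ j, mulOp (a i j) ∘L PiLp.proj 2 (fun _ : Fin d => L2 Ω) j

/-- The compression `ι₀* a ι₀` of the multiplication operator `a` to `g₀(Ω)`, where `ι₀` is the
embedding of `g₀(Ω)` into `L₂(Ω)ᵈ`, so that `ι₀*` is the orthogonal projection onto `g₀(Ω)`. -/
def compression (hd : 0 < d) {Ω : Opens (EuclideanSpace ℝ (Fin d))}
    (hΩ : Bornology.IsBounded (Ω : Set (EuclideanSpace ℝ (Fin d)))) (a : Coeff Ω) :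
    g0 Ω →L[ℂ] g0 Ω :=
  haveI := hasOrthogonalProjection_g0 hd hΩ
  (g0 Ω).orthogonalProjectionOnto ∘L coeffOp a ∘L (g0 Ω).subtypeL

/-- `u ∈ H₀¹(Ω)` solves `-div a grad u = f` for `f ∈ H⁻¹(Ω) = H₀¹(Ω)*`, i.e.
`⟨a grad u, grad φ⟩ = f(φ)` for all `φ ∈ H₀¹(Ω)` (scalar products are linear in the second
component). -/
def IsSolution {Ω : Opens (EuclideanSpace ℝ (Fin d))} (a : Coeff Ω) (f : StrongDual ℂ (H10 Ω))
    (u : H10 Ω) : Prop :=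
  ∀ φ : H10 Ω, ⟪coeffOp a (grad Ω u), grad Ω φ⟫_ℂ = f φ

/-- Classical `G`-convergence of `(aₙ)` to `a`; the convergence of the solutions is weak
convergence in `H₀¹(Ω)`. -/
def GConverges {Ω : Opens (EuclideanSpace ℝ (Fin d))} (a : ℕ → Coeff Ω) (aLim : Coeff Ω) : Prop :=
  ∀ (f : StrongDual ℂ (H10 Ω)) (u : ℕ → H10 Ω), (∀ n, IsSolution (a n) f (u n)) →
    ∃ uLim : H10 Ω,
      Tendsto (fun n => toWeakSpace ℂ (H10 Ω) (u n)) atTop (𝓝 (toWeakSpace ℂ (H10 Ω) uLim)) ∧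
      IsSolution aLim f uLim

end

end HolG

open HolG

/-! Write `b n` for the inverses of the compressions and `bL` for the inverse of the limit. All
three assertions are compared with a single one: `b n` converges to `bL` in the weak operator
topology. Classical convergence is equivalent to it (`gConverges_iff_tendsto_inner`): by Poincaré's
inequality `grad` identifies `H10` with `g0`, and under this identification the solutions are `b n
F`, with `F` the Riesz representative of the right-hand side. Holomorphic convergence implies it
(`HolGConverges.tendsto_inner`): if `‖b n‖ ≤ C`, the resolvents are holomorphic and bounded by `2 *
C` on the disc of radius `(2 * C)⁻¹` about `0`. Convergence near a point of `ω` close to `0`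
therefore spreads to `0`, where the resolvent is `b n`. Conversely (`exists_subseq_holGConverges`),
the resolvent is the Neumann series of `z ^ k • b n ^ (k + 1)`. Weak convergence of `b n` says
nothing about its higher powers, so a subsequence is needed along which every power converges
weakly. This is why only the assertion about subsequences is equivalent to classical convergence.
The way back from subsequences is the usual subsequence principle. -/

namespace HolG

/-! ### Convergence of bounded sequences of holomorphic functions -/

/-- Locally uniform convergence of holomorphic functions is inherited by all derivatives. -/
lemma tendstoLocallyUniformlyOn_iteratedDeriv {h : ℕ → ℂ → ℂ} {F : ℂ → ℂ} {V : Set ℂ}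
    (hV : IsOpen V) (hh : ∀ n, DifferentiableOn ℂ (h n) V)
    (hlim : TendstoLocallyUniformlyOn h F atTop V) (k : ℕ) :
    TendstoLocallyUniformlyOn (fun n => iteratedDeriv k (h n)) (iteratedDeriv k F) atTop V ∧
      ∀ n, DifferentiableOn ℂ (iteratedDeriv k (h n)) V := by
  induction k with
  | zero => simpa only [iteratedDeriv_zero] using ⟨hlim, hh⟩
  | succ k ih =>
    simp only [iteratedDeriv_succ]
    exact ⟨ih.1.deriv (Eventually.of_forall ih.2) hV, fun n => (ih.2 n).deriv hV⟩

/-- A bounded sequence of holomorphic functions on a ball that converges locally uniformly near the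
centre to a function holomorphic on the ball converges pointwise on the ball. -/
theorem tendsto_of_tendstoLocallyUniformlyOn_of_bounded {h : ℕ → ℂ → ℂ} {F : ℂ → ℂ} {c : ℂ}
    {s M : ℝ} {V : Set ℂ} (hh : ∀ n, DifferentiableOn ℂ (h n) (Metric.ball c s))
    (hM : ∀ n, ∀ z ∈ Metric.ball c s, ‖h n z‖ ≤ M)
    (hF : DifferentiableOn ℂ F (Metric.ball c s)) (hV : IsOpen V) (hc : c ∈ V)
    (hVs : V ⊆ Metric.ball c s) (hlim : TendstoLocallyUniformlyOn h F atTop V) {w : ℂ}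
    (hw : w ∈ Metric.ball c s) : Tendsto (fun n => h n w) atTop (𝓝 (F w)) := by
  -- Cauchy's estimates on the circle of radius `t` bound the `k`-th Taylor term at `w` by `M *
  -- (dist w c / t) ^ k`, uniformly in `n`; `t > dist w c` makes this summable.
  obtain ⟨t, hwt, hts⟩ := exists_between (Metric.mem_ball.1 hw)
  have ht : 0 < t := dist_nonneg.trans_lt hwt
  have hq : dist w c / t < 1 := (div_lt_one ht).2 hwt
  have hsub : Metric.closedBall c t ⊆ Metric.ball c s := Metric.closedBall_subset_ball hts
  have hT : ∀ {g : ℂ → ℂ}, DifferentiableOn ℂ g (Metric.ball c s) →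
      g w = ∑' k : ℕ, (k.factorial : ℂ)⁻¹ • (w - c) ^ k • iteratedDeriv k g c :=
    fun hg => (Complex.hasSum_taylorSeries_on_ball hg hw).tsum_eq.symm
  simp only [hT (hh _), hT hF]
  refine tendsto_tsum_of_dominated_convergence
    (bound := fun k => M * (dist w c / t) ^ k)
    ((summable_geometric_of_lt_one (by positivity) hq).mul_left M) (fun k => ?_)
    (Eventually.of_forall fun n k => ?_)
  · exact (((tendstoLocallyUniformlyOn_iteratedDeriv hV (fun n => (hh n).mono hVs) hlim
      k).1.tendsto_at hc).const_smul _).const_smul _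
  · have h1 := Complex.norm_iteratedDeriv_le_of_forall_mem_sphere_norm_le k ht
      ((hh n).diffContOnCl_ball hsub)
      (fun z hz => hM n z (hsub (Metric.sphere_subset_closedBall hz)))
    rw [norm_smul, norm_smul, norm_inv, norm_pow, Complex.norm_natCast, ← dist_eq_norm]
    calc ((k.factorial : ℝ))⁻¹ * (dist w c ^ k * ‖iteratedDeriv k (h n) c‖)
        ≤ ((k.factorial : ℝ))⁻¹ * (dist w c ^ k * (k.factorial * M / t ^ k)) := by gcongr
      _ = M * (dist w c / t) ^ k := by
        have : (k.factorial : ℝ) ≠ 0 := by exact_mod_cast k.factorial_ne_zero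
        rw [div_pow]
        field_simp

/-- The radius is half of the guaranteed radius of convergence `C⁻¹`, which makes the ratio `1 / 2`
on the whole disc; every later series estimate uses this majorant. -/
lemma norm_pow_smul_le_geometric {E : Type*} [NormedAddCommGroup E] [NormedSpace ℂ E]
    {C M : ℝ} (hC : 0 < C) {c : E} {k : ℕ} (hc : ‖c‖ ≤ M * C ^ k) {z : ℂ}
    (hz : z ∈ Metric.ball (0 : ℂ) (2 * C)⁻¹) : ‖z ^ k • c‖ ≤ M * (1 / 2) ^ k := by
  have hz' : ‖z‖ ≤ (2 * C)⁻¹ := (mem_ball_zero_iff.1 hz).le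
  rw [norm_smul, norm_pow]
  calc ‖z‖ ^ k * ‖c‖ ≤ ((2 * C)⁻¹) ^ k * (M * C ^ k) := by gcongr
    _ = M * ((2 * C)⁻¹ * C) ^ k := by rw [mul_pow]; ring
    _ = M * (1 / 2) ^ k := by congr 2; field_simp

lemma differentiableOn_tsum_pow_smul {E : Type*} [NormedAddCommGroup E] [NormedSpace ℂ E]
    [CompleteSpace E] {C M : ℝ} (hC : 0 < C) {c : ℕ → E}
    (hc : ∀ k, ‖c k‖ ≤ M * C ^ k) :
    DifferentiableOn ℂ (fun z : ℂ => ∑' k, z ^ k • c k) (Metric.ball 0 (2 * C)⁻¹) :=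
  Complex.differentiableOn_tsum_of_summable_norm
    ((summable_geometric_of_lt_one (by norm_num) (by norm_num)).mul_left M)
    (fun k => by fun_prop) Metric.isOpen_ball
    (fun k _ hw => norm_pow_smul_le_geometric hC (hc k) hw)

/-! ### Neumann series -/

section Neumann

variable {H : Type*} [NormedAddCommGroup H] [InnerProductSpace ℂ H] [CompleteSpace H]

/-- Factor `a - z = a (1 - z b)` and invert the second factor by the geometric series. -/
lemma isUnit_and_hasSum_shiftInv {a b : H →L[ℂ] H} (hab : a * b = 1) (hba : b * a = 1) {z : ℂ}
    (hz : ‖z • b‖ < 1) :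
    IsUnit (a - algebraMap ℂ (H →L[ℂ] H) z) ∧
      HasSum (fun k : ℕ => z ^ k • b ^ (k + 1)) (shiftInv a z) := by
  let u : (H →L[ℂ] H)ˣ := ⟨a, b, hab, hba⟩ * Units.oneSub (z • b) hz
  have hu : (u : H →L[ℂ] H) = a - algebraMap ℂ (H →L[ℂ] H) z := by
    simp [u, mul_sub, hab, Algebra.algebraMap_eq_smul_one]
  refine ⟨⟨u, hu⟩, ?_⟩
  have hinv : shiftInv a z = (∑' k, (z • b) ^ k) * b := by
    rw [shiftInv, ← hu, Ring.inverse_unit]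
    rfl
  rw [hinv]
  have := (summable_geometric_of_norm_lt_one hz).hasSum.mul_right b
  simpa only [smul_pow, smul_mul_assoc, ← pow_succ] using this

lemma norm_smul_lt_one {b : H →L[ℂ] H} {C : ℝ} (hC : 0 < C) (hb : ‖b‖ ≤ C) {z : ℂ}
    (hz : z ∈ Metric.ball (0 : ℂ) (2 * C)⁻¹) : ‖z • b‖ < 1 := by
  have := norm_pow_smul_le_geometric (k := 1) (M := 1) (c := b) hC (by simpa using hb) hz
  simp only [pow_one, one_mul] at this
  linarith

omit [CompleteSpace H] in
lemma norm_pow_succ_le {b : H →L[ℂ] H} {C : ℝ} (hb : ‖b‖ ≤ C) (k : ℕ) :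
    ‖b ^ (k + 1)‖ ≤ C * C ^ k := by
  refine (norm_pow_le' b k.succ_pos).trans ?_
  rw [← pow_succ']
  gcongr

lemma norm_shiftInv_le {a b : H →L[ℂ] H} (hab : a * b = 1) (hba : b * a = 1) {C : ℝ} (hC : 0 < C)
    (hb : ‖b‖ ≤ C) {z : ℂ} (hz : z ∈ Metric.ball (0 : ℂ) (2 * C)⁻¹) :
    ‖shiftInv a z‖ ≤ 2 * C := by
  rw [← (isUnit_and_hasSum_shiftInv hab hba (norm_smul_lt_one hC hb hz)).2.tsum_eq, mul_comm]
  exact tsum_of_norm_bounded (hasSum_geometric_two.mul_left C)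
    fun k => norm_pow_smul_le_geometric hC (norm_pow_succ_le hb k) hz

lemma inner_shiftInv_eq_tsum {a b : H →L[ℂ] H} (hab : a * b = 1) (hba : b * a = 1) {C : ℝ}
    (hC : 0 < C) (hb : ‖b‖ ≤ C) {z : ℂ} (hz : z ∈ Metric.ball (0 : ℂ) (2 * C)⁻¹) (φ ψ : H) :
    ⟪ψ, shiftInv a z φ⟫_ℂ = ∑' k : ℕ, z ^ k • ⟪ψ, (b ^ (k + 1)) φ⟫_ℂ := by
  have h := (isUnit_and_hasSum_shiftInv hab hba (norm_smul_lt_one hC hb hz)).2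
  have h2 := h.mapL (innerSL ℂ ψ ∘L ContinuousLinearMap.apply ℂ H φ)
  simpa [inner_smul_right] using h2.tsum_eq.symm

omit [CompleteSpace H] in
lemma norm_inner_pow_le {b : H →L[ℂ] H} {C : ℝ} (hb : ‖b‖ ≤ C) (φ ψ : H) (k : ℕ) :
    ‖⟪ψ, (b ^ (k + 1)) φ⟫_ℂ‖ ≤ (‖ψ‖ * C * ‖φ‖) * C ^ k :=
  calc ‖⟪ψ, (b ^ (k + 1)) φ⟫_ℂ‖ ≤ ‖ψ‖ * ((C * C ^ k) * ‖φ‖) :=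
        (norm_inner_le_norm _ _).trans (by
          gcongr; exact (b ^ (k + 1)).le_of_opNorm_le (norm_pow_succ_le hb k) φ)
    _ = _ := by ring

lemma differentiableOn_inner_shiftInv {a b : H →L[ℂ] H} (hab : a * b = 1) (hba : b * a = 1) {C : ℝ}
    (hC : 0 < C) (hb : ‖b‖ ≤ C) (φ ψ : H) :
    DifferentiableOn ℂ (fun z => ⟪ψ, shiftInv a z φ⟫_ℂ) (Metric.ball 0 (2 * C)⁻¹) :=
  (differentiableOn_tsum_pow_smul hC (norm_inner_pow_le hb φ ψ)).congr
    fun _ hz => inner_shiftInv_eq_tsum hab hba hC hb hz φ ψ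

end Neumann

/-! ### Compactness -/

/-- A pointwise bounded sequence of functions on a countable set has a pointwise convergent
subsequence. -/
lemma exists_subseq_tendsto_of_bounded {ι : Type*} [Countable ι] (x : ℕ → ι → ℂ) (M : ι → ℝ)
    (hM : ∀ n i, ‖x n i‖ ≤ M i) :
    ∃ κ : ℕ → ℕ, StrictMono κ ∧ ∀ i, ∃ l, Tendsto (fun n => x (κ n) i) atTop (𝓝 l) := by
  -- By Tychonoff the product of discs is compact. It is metrizable because `ι` is countable, so it
  -- is sequentially compact and no explicit diagonal argument is needed.
  have hc : IsCompact (Set.pi Set.univ fun i => Metric.closedBall (0 : ℂ) (M i)) :=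
    isCompact_univ_pi fun i => isCompact_closedBall _ _
  obtain ⟨l, -, κ, hκ, hl⟩ := hc.tendsto_subseq (x := x)
    (fun n i _ => mem_closedBall_zero_iff.2 (hM n i))
  exact ⟨κ, hκ, fun i => ⟨l i, (tendsto_pi_nhds.1 hl) i⟩⟩

/-- A sequence of uniformly Lipschitz functions that converges pointwise on a dense set converges
pointwise. -/
lemma exists_tendsto_of_denseRange {E ι : Type*} [PseudoMetricSpace E] {g : ℕ → E → ℂ} {K : ℝ}
    (hg : ∀ n x y, dist (g n x) (g n y) ≤ K * dist x y) {e : ι → E} (he : DenseRange e)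
    (h : ∀ i, ∃ l, Tendsto (fun n => g n (e i)) atTop (𝓝 l)) (x : E) :
    ∃ l, Tendsto (fun n => g n x) atTop (𝓝 l) := by
  refine cauchySeq_tendsto_of_complete (Metric.cauchySeq_iff.2 fun ε hε => ?_)
  -- `|K| + 1` keeps the denominator positive whatever the sign of `K`.
  obtain ⟨i, hi⟩ := he.exists_dist_lt x (ε := ε / (3 * (|K| + 1))) (by positivity)
  obtain ⟨l, hl⟩ := h i
  obtain ⟨N, hN⟩ := Metric.cauchySeq_iff.1 hl.cauchySeq (ε / 3) (by positivity)
  have hd : ∀ n, dist (g n x) (g n (e i)) ≤ ε / 3 := fun n =>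
    calc dist (g n x) (g n (e i)) ≤ K * dist x (e i) := hg n x _
      _ ≤ (|K| + 1) * (ε / (3 * (|K| + 1))) := by
        gcongr
        linarith [le_abs_self K]
      _ = ε / 3 := by field_simp
  refine ⟨N, fun m hm n hn => ?_⟩
  have h1 := dist_triangle4 (g m x) (g m (e i)) (g n (e i)) (g n x)
  have h2 := hd n
  rw [dist_comm] at h2
  linarith [hd m, hN m hm n hn]

/-- On the disc the difference of the two series is at most `∑ (2 * C)⁻¹ ^ k * ‖l k - c n k‖`, which
does not depend on `z` and tends to `0` by dominated convergence. -/
lemma tendstoUniformlyOn_tsum_pow_smul {C M : ℝ} (hC : 0 < C) {c : ℕ → ℕ → ℂ} {l : ℕ → ℂ}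
    (hc : ∀ n k, ‖c n k‖ ≤ M * C ^ k) (hl : ∀ k, Tendsto (fun n => c n k) atTop (𝓝 (l k))) :
    TendstoUniformlyOn (fun n (z : ℂ) => ∑' k, z ^ k • c n k) (fun z => ∑' k, z ^ k • l k) atTop
      (Metric.ball 0 (2 * C)⁻¹) := by
  have hlc : ∀ k, ‖l k‖ ≤ M * C ^ k := fun k =>
    le_of_tendsto (hl k).norm (Eventually.of_forall fun n => hc n k)
  have hgeo : ∀ A : ℝ, Summable fun k : ℕ => A * (1 / 2 : ℝ) ^ k := fun A =>
    (summable_geometric_of_lt_one (by norm_num) (by norm_num)).mul_left A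
  have hd : ∀ n k, ‖l k - c n k‖ ≤ (2 * M) * C ^ k := fun n k => by
    have := norm_sub_le (l k) (c n k)
    linarith [hlc k, hc n k]
  have hr : ∀ n k, ‖((2 * C)⁻¹ ^ k * ‖l k - c n k‖ : ℝ)‖ ≤ (2 * M) * (1 / 2) ^ k := fun n k => by
    rw [Real.norm_of_nonneg (by positivity)]
    calc (2 * C)⁻¹ ^ k * ‖l k - c n k‖ ≤ (2 * C)⁻¹ ^ k * ((2 * M) * C ^ k) := by
          gcongr; exact hd n k
      _ = (2 * M) * ((2 * C)⁻¹ * C) ^ k := by rw [mul_pow]; ring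
      _ = (2 * M) * (1 / 2) ^ k := by congr 2; field_simp
  have hε : Tendsto (fun n => ∑' k, (2 * C)⁻¹ ^ k * ‖l k - c n k‖) atTop (𝓝 0) := by
    have := tendsto_tsum_of_dominated_convergence (hgeo (2 * M))
      (f := fun n k => (2 * C)⁻¹ ^ k * ‖l k - c n k‖) (g := fun _ => 0) (𝓕 := atTop)
      (fun k => by
        simpa using (((tendsto_const_nhds (x := l k)).sub (hl k)).norm).const_mul ((2 * C)⁻¹ ^ k))
      (Eventually.of_forall hr)
    simpa using this
  refine Metric.tendstoUniformlyOn_iff.2 fun ε hε0 => ?_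
  filter_upwards [hε.eventually_lt_const hε0] with n hn z hz
  have s1 : Summable fun k => z ^ k • l k := Summable.of_norm_bounded (hgeo M)
    fun k => norm_pow_smul_le_geometric hC (hlc k) hz
  have s2 : Summable fun k => z ^ k • c n k := Summable.of_norm_bounded (hgeo M)
    fun k => norm_pow_smul_le_geometric hC (hc n k) hz
  rw [dist_eq_norm, ← s1.tsum_sub s2]
  refine (tsum_of_norm_bounded (Summable.of_norm_bounded (hgeo (2 * M)) (hr n)).hasSum
    fun k => ?_).trans_lt hn
  rw [← smul_sub, norm_smul, norm_pow]
  have := (mem_ball_zero_iff.1 hz).le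
  gcongr

/-! ### Holomorphic `G`-convergence and weak convergence of the inverses -/

section Abstract

variable {H : Type*} [NormedAddCommGroup H] [InnerProductSpace ℂ H] [CompleteSpace H]

/-- A sequence all of whose inner products converge is weakly convergent. -/
lemma exists_tendsto_inner (x : ℕ → H)
    (h : ∀ ψ, ∃ l, Tendsto (fun n => ⟪ψ, x n⟫_ℂ) atTop (𝓝 l)) :
    ∃ v, ∀ ψ, Tendsto (fun n => ⟪ψ, x n⟫_ℂ) atTop (𝓝 ⟪ψ, v⟫_ℂ) := by
  choose l hl using h
  -- The inner product is linear in its second slot, so the functionals are `⟪x n, ·⟫` and the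
  -- limits get conjugated. Banach–Steinhaus makes the pointwise limit continuous, and Riesz
  -- represents it.
  have hT : Tendsto (fun n ψ => innerSL ℂ (x n) ψ) atTop (𝓝 fun ψ => (starRingEnd ℂ) (l ψ)) :=
    tendsto_pi_nhds.2 fun ψ => by
      simpa [Function.comp_def] using (Complex.continuous_conj.tendsto _).comp (hl ψ)
  let T : StrongDual ℂ H := continuousLinearMapOfTendsto _ hT
  refine ⟨(InnerProductSpace.toDual ℂ H).symm T, fun ψ => ?_⟩
  have hv : ⟪ψ, (InnerProductSpace.toDual ℂ H).symm T⟫_ℂ = l ψ := by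
    rw [← inner_conj_symm, InnerProductSpace.toDual_symm_apply]
    exact Complex.conj_conj (l ψ)
  rw [hv]
  exact hl ψ

-- Weak lower semicontinuity of the norm; testing against `v` itself suffices.
omit [CompleteSpace H] in
lemma norm_le_of_tendsto_inner {x : ℕ → H} {v : H} {M : ℝ} (hx : ∀ n, ‖x n‖ ≤ M)
    (h : Tendsto (fun n => ⟪v, x n⟫_ℂ) atTop (𝓝 ⟪v, v⟫_ℂ)) : ‖v‖ ≤ M := by
  have h1 : ‖v‖ * ‖v‖ ≤ ‖v‖ * M := by
    have := le_of_tendsto h.norm (Eventually.of_forall fun n =>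
      (norm_inner_le_norm v (x n)).trans (mul_le_mul_of_nonneg_left (hx n) (norm_nonneg v)))
    rwa [inner_self_eq_norm_sq_to_K, norm_pow, RCLike.norm_ofReal, abs_norm, sq] at this
  rcases (norm_nonneg v).eq_or_lt with h0 | h0
  · exact h0 ▸ (norm_nonneg _).trans (hx 0)
  · exact le_of_mul_le_mul_left h1 h0

omit [CompleteSpace H] in
lemma shiftInv_zero {a b : H →L[ℂ] H} (hab : a * b = 1) (hba : b * a = 1) : shiftInv a 0 = b := by
  have : a = ((⟨a, b, hab, hba⟩ : (H →L[ℂ] H)ˣ) : H →L[ℂ] H) := rfl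
  rw [shiftInv, map_zero, sub_zero, this, Ring.inverse_unit]
  rfl

/-- If `(aₙ)` holomorphically `G`-converges to an invertible operator and the inverses `aₙ⁻¹` are
uniformly bounded, then these converge in the weak operator topology. -/
theorem HolGConverges.tendsto_inner {a b : ℕ → H →L[ℂ] H} {aL bL : H →L[ℂ] H}
    (hab : ∀ n, a n * b n = 1) (hba : ∀ n, b n * a n = 1) (hL : aL * bL = 1) {C : ℝ} (hC : 0 < C)
    (hb : ∀ n, ‖b n‖ ≤ C) (h : HolGConverges a (Function.graph aL)) (φ ψ : H) :
    Tendsto (fun n => ⟪ψ, b n φ⟫_ℂ) atTop (𝓝 ⟪ψ, bL φ⟫_ℂ) := by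
  obtain ⟨ω, h⟩ := h
  have hmem : (φ, bL φ) ∈ limitInverse a ω := by
    rw [← h.inv_eq]
    exact congrArg (fun T : H →L[ℂ] H => T φ) hL
  obtain ⟨f, ⟨-, hf⟩, U, F, hU, h0, hF, hFf, hF0⟩ := hmem
  obtain ⟨s, hs, hsU⟩ := Metric.isOpen_iff.1
    (hU.inter (Metric.isOpen_ball (x := (0 : ℂ)) (ε := (2 * C)⁻¹))) 0
    ⟨h0, Metric.mem_ball_self (by positivity)⟩
  -- `0` need not lie in `ω`. With `‖c‖ < s / 2`, the disc of radius `s / 2` about `c` contains `0`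
  -- and stays inside `ball 0 s`, where both `F` and all resolvents are holomorphic.
  obtain ⟨c, hcω, hc⟩ := Metric.mem_closure_iff.1 h.zero_mem_closure (s / 2) (by positivity)
  have hsub : Metric.ball c (s / 2) ⊆ Metric.ball 0 s :=
    Metric.ball_subset_ball' (by rw [dist_comm c]; linarith)
  have hsubU : Metric.ball c (s / 2) ⊆ U := fun z hz => (hsU (hsub hz)).1
  have hsubC : Metric.ball c (s / 2) ⊆ Metric.ball 0 (2 * C)⁻¹ :=
    fun z hz => (hsU (hsub hz)).2
  have key := tendsto_of_tendstoLocallyUniformlyOn_of_bounded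
    (h := fun n z => ⟪ψ, shiftInv (a n) z φ⟫_ℂ) (F := fun z => ⟪ψ, F z⟫_ℂ) (c := c) (s := s / 2)
    (M := ‖ψ‖ * (2 * C * ‖φ‖)) (V := ω ∩ Metric.ball c (s / 2)) (w := 0)
    (fun n => (differentiableOn_inner_shiftInv (hab n) (hba n) hC (hb n) φ ψ).mono hsubC)
    (fun n z hz => (norm_inner_le_norm _ _).trans (by
      gcongr
      exact (shiftInv (a n) z).le_of_opNorm_le
        (norm_shiftInv_le (hab n) (hba n) hC (hb n) (hsubC hz)) φ))
    ((innerSL ℂ ψ).differentiable.comp_differentiableOn (hF.mono hsubU))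
    (h.isOpen.inter Metric.isOpen_ball) ⟨hcω, Metric.mem_ball_self (by positivity)⟩
    Set.inter_subset_right
    ((tendstoLocallyUniformlyOn_iff_forall_isCompact (h.isOpen.inter Metric.isOpen_ball)).2
      fun K hK hKc => (hf ψ K (hK.trans Set.inter_subset_left) hKc).congr_right fun z hz => by
        simp only [hFf ⟨hsubU (hK hz).2, (hK hz).1⟩])
    (by simpa [dist_comm] using hc)
  simpa only [shiftInv_zero (hab _) (hba _), hF0] using key

/-- A sequence of operators with uniformly bounded inverses that converge in the weak operator
topology to the inverse of `aL` has a subsequence that holomorphically `G`-converges to `aL`. -/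
theorem exists_subseq_holGConverges [SeparableSpace H] {a b : ℕ → H →L[ℂ] H}
    {aL bL : H →L[ℂ] H} (hab : ∀ n, a n * b n = 1) (hba : ∀ n, b n * a n = 1)
    (hLab : aL * bL = 1) (hLba : bL * aL = 1) {C : ℝ} (hC : 0 < C) (hb : ∀ n, ‖b n‖ ≤ C)
    (hw : ∀ φ ψ, Tendsto (fun n => ⟪ψ, b n φ⟫_ℂ) atTop (𝓝 ⟪ψ, bL φ⟫_ℂ)) :
    ∃ κ : ℕ → ℕ, StrictMono κ ∧ HolGConverges (fun n => a (κ n)) (Function.graph aL) := by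
  -- One subsequence serves all powers `k + 1` and all pairs from a countable dense set; `hconv'`
  -- then passes to arbitrary vectors, one slot at a time.
  obtain ⟨κ, hκ, hconv⟩ := exists_subseq_tendsto_of_bounded (ι := ℕ × ℕ × ℕ)
    (fun n p => ⟪denseSeq H p.2.1, (b n ^ (p.1 + 1)) (denseSeq H p.2.2)⟫_ℂ) _
    (fun n p => norm_inner_pow_le (hb n) _ _ _)
  have hnorm : ∀ n k φ, ‖(b n ^ (k + 1)) φ‖ ≤ (C * ‖φ‖) * C ^ k := fun n k φ =>
    ((b n ^ (k + 1)).le_of_opNorm_le (norm_pow_succ_le (hb n) k) φ).trans_eq (by ring)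
  have hconv' : ∀ k φ ψ, ∃ l, Tendsto (fun n => ⟪ψ, (b (κ n) ^ (k + 1)) φ⟫_ℂ) atTop (𝓝 l) := by
    intro k φ
    refine exists_tendsto_of_denseRange (K := C * ‖φ‖ * C ^ k) (fun n x y => ?_)
      (denseRange_denseSeq H) fun i => ?_
    · rw [dist_eq_norm, ← inner_sub_left, mul_comm, dist_eq_norm]
      exact (norm_inner_le_norm _ _).trans (by gcongr; exact hnorm _ _ _)
    · refine exists_tendsto_of_denseRange (K := ‖denseSeq H i‖ * (C * C ^ k))
        (g := fun n φ => ⟪denseSeq H i, (b (κ n) ^ (k + 1)) φ⟫_ℂ) (fun n x y => ?_)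
        (denseRange_denseSeq H) (fun j => hconv (k, i, j)) φ
      rw [dist_eq_norm, ← inner_sub_right, ← map_sub, mul_assoc, dist_eq_norm]
      exact (norm_inner_le_norm _ _).trans (by
        gcongr; exact (b (κ n) ^ (k + 1)).le_of_opNorm_le (norm_pow_succ_le (hb _) k) _)
  choose v hv using fun k φ => exists_tendsto_inner _ (hconv' k φ)
  have hvn : ∀ φ k, ‖v k φ‖ ≤ (C * ‖φ‖) * C ^ k := fun φ k =>
    norm_le_of_tendsto_inner (fun n => hnorm (κ n) k φ) (hv k φ (v k φ))
  -- Only the coefficient with index `0`, which belongs to the first power, is identified through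
  -- `bL`; the others need not be powers of `bL`, and do not matter at `z = 0`.
  have hv0 : ∀ φ, v 0 φ = bL φ := fun φ => ext_inner_left ℂ fun ψ =>
    tendsto_nhds_unique (hv 0 φ ψ) (by
      simpa [Function.comp_def] using (hw φ ψ).comp hκ.tendsto_atTop)
  let f : H → ℂ → H := fun φ z => ∑' k, z ^ k • v k φ
  have hf0 : ∀ φ, f φ 0 = bL φ := fun φ => by
    simp only [f]
    rw [tsum_eq_single 0 (fun k hk => by simp [hk]), pow_zero, one_smul, hv0]
  have hfin : ∀ φ ψ, ∀ z ∈ Metric.ball (0 : ℂ) (2 * C)⁻¹,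
      ∑' k, z ^ k • ⟪ψ, v k φ⟫_ℂ = ⟪ψ, f φ z⟫_ℂ := fun φ ψ z hz => by
    have hs : Summable fun k => z ^ k • v k φ := .of_norm_bounded
      ((summable_geometric_of_lt_one (by norm_num) (by norm_num)).mul_left (C * ‖φ‖))
      fun k => norm_pow_smul_le_geometric hC (hvn φ k) hz
    simpa [inner_smul_right] using (hs.hasSum.mapL (innerSL ℂ ψ)).tsum_eq
  have hres : ∀ φ, IsResolventLimit (fun n => a (κ n)) (Metric.ball 0 (2 * C)⁻¹) φ (f φ) := by
    refine fun φ => ⟨differentiableOn_tsum_pow_smul hC (hvn φ), fun ψ K hK _ => ?_⟩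
    refine (((tendstoUniformlyOn_tsum_pow_smul hC
      (fun n k => norm_inner_pow_le (hb (κ n)) φ ψ k) (fun k => hv k φ ψ)).congr
      (Eventually.of_forall fun n z hz => ?_)).congr_right
      fun z hz => hfin φ ψ z hz).mono hK
    exact (inner_shiftInv_eq_tsum (hab _) (hba _) hC (hb _) hz φ ψ).symm
  have h0 : (0 : ℂ) ∈ Metric.ball (0 : ℂ) (2 * C)⁻¹ := Metric.mem_ball_self (by positivity)
  have hext : ∀ φ, ExtendsToZero (f φ) (Metric.ball 0 (2 * C)⁻¹) (bL φ) := fun φ =>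
    ⟨_, f φ, Metric.isOpen_ball, h0, (hres φ).1, fun _ _ => rfl, hf0 φ⟩
  refine ⟨κ, hκ, Metric.ball 0 (2 * C)⁻¹, Metric.isOpen_ball, fun n z hz => ?_, subset_closure h0,
    fun K hK _ => ⟨2 * C, fun n z hz => norm_shiftInv_le (hab _) (hba _) hC (hb _) (hK hz)⟩,
    ?_, ?_⟩
  · exact spectrum.mem_resolventSet_iff.2 (IsUnit.sub_iff.1
      (isUnit_and_hasSum_shiftInv (hab _) (hba _) (norm_smul_lt_one hC (hb _) hz)).1)
  · convert dense_univ
    exact Set.eq_univ_of_forall fun φ => ⟨f φ, bL φ, hres φ, hext φ⟩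
  · ext ⟨φ, χ⟩
    constructor
    · intro h
      have h' : aL χ = φ := h
      have : χ = bL φ := by
        rw [← h']
        exact (congrArg (fun T : H →L[ℂ] H => T χ) hLba).symm
      exact this ▸ ⟨f φ, hres φ, hext φ⟩
    · rintro ⟨g, ⟨-, hg⟩, U, F, -, h0U, -, hFg, rfl⟩
      -- Here `ω` contains `0`, so any extension has the value `g 0` there, and this is the weak
      -- limit of `b (κ n) φ`.
      have hg0 : F 0 = bL φ := by
        rw [hFg ⟨h0U, h0⟩]
        refine ext_inner_left ℂ fun ψ => tendsto_nhds_unique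
          ((hg ψ {0} (Set.singleton_subset_iff.2 h0) isCompact_singleton).tendsto_at rfl) ?_
        simpa only [shiftInv_zero (hab _) (hba _), Function.comp_def] using (hw φ ψ).comp hκ.tendsto_atTop
      change aL (F 0) = φ
      rw [hg0]
      exact congrArg (fun T : H →L[ℂ] H => T φ) hLab

end Abstract

/-! ### Classical `G`-convergence and weak convergence of the inverses -/

section Classical

lemma tendsto_toWeakSpace_iff {E : Type*} [NormedAddCommGroup E] [NormedSpace ℂ E] {u : ℕ → E}
    {v : E} :
    Tendsto (fun n => toWeakSpace ℂ E (u n)) atTop (𝓝 (toWeakSpace ℂ E v)) ↔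
      ∀ l : StrongDual ℂ E, Tendsto (fun n => l (u n)) atTop (𝓝 (l v)) :=
  WeakBilin.tendsto_iff_forall_eval_tendsto (topDualPairing ℂ E).flip fun _ _ h =>
    SeparatingDual.eq_iff_forall_dual_eq.2 fun l => congrArg (fun T => T l) h

variable {d : ℕ} (hd : 0 < d) {Ω : Opens (EuclideanSpace ℝ (Fin d))}
  (hΩ : Bornology.IsBounded (Ω : Set (EuclideanSpace ℝ (Fin d))))

lemma inner_compression (a : Coeff Ω) (x y : g0 Ω) :
    ⟪compression hd hΩ a x, y⟫_ℂ = ⟪coeffOp a x, (y : L2Vec Ω)⟫_ℂ :=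
  haveI := hasOrthogonalProjection_g0 hd hΩ
  (g0 Ω).inner_orthogonalProjectionOnto_eq_of_mem_right y (coeffOp a x)

include hd hΩ in
/-- By Poincaré's inequality, the gradient is an isomorphism `H₀¹(Ω) → g₀(Ω)`. -/
theorem exists_gradEquiv : ∃ e : H10 Ω ≃L[ℂ] g0 Ω, ∀ u, (e u : L2Vec Ω) = grad Ω u := by
  have : CompleteSpace (H10 Ω) := (testPairs Ω).isClosed_topologicalClosure.completeSpace_coe
  have : CompleteSpace (g0 Ω) := (isClosed_g0 hd hΩ).completeSpace_coe
  obtain ⟨C, -, hC⟩ := poincare hd hΩ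
  let T : H10 Ω →L[ℂ] g0 Ω := (grad Ω).codRestrict (g0 Ω) fun u => ⟨u, rfl⟩
  -- Both spaces are complete, so the open mapping theorem gives the continuous inverse; Poincaré's
  -- inequality gives injectivity.
  refine ⟨ContinuousLinearEquiv.ofBijective T ?_ ?_, fun u => rfl⟩
  · refine LinearMap.ker_eq_bot'.2 fun u hu => ?_
    have h2 : u.1.snd = 0 := congrArg Subtype.val hu
    have h1 : ‖u.1.fst‖ ≤ C * ‖u.1.snd‖ := hC u.1 u.2
    rw [h2, norm_zero, mul_zero, norm_le_zero_iff] at h1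
    exact Subtype.ext (WithLp.ofLp_injective 2 (Prod.ext h1 h2))
  · refine LinearMap.range_eq_top.2 ?_
    rintro ⟨_, u, rfl⟩
    exact ⟨u, rfl⟩

/-- The gradients `e v` exhaust `g0`, so testing against all of them determines the compressed
vector. -/
lemma isSolution_iff (e : H10 Ω ≃L[ℂ] g0 Ω) (he : ∀ u, (e u : L2Vec Ω) = grad Ω u) (a : Coeff Ω)
    (f : StrongDual ℂ (H10 Ω)) (F : g0 Ω) (hF : ∀ v, f v = ⟪F, e v⟫_ℂ) (u : H10 Ω) :
    IsSolution a f u ↔ compression hd hΩ a (e u) = F := by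
  have key : ∀ v, ⟪coeffOp a (grad Ω u), grad Ω v⟫_ℂ = ⟪compression hd hΩ a (e u), e v⟫_ℂ :=
    fun v => by rw [inner_compression, he, he]
  simp only [IsSolution, key, hF]
  refine ⟨fun h => ext_inner_right ℂ fun y => ?_, fun h v => by rw [h]⟩
  simpa using h (e.symm y)

/-- Classical `G`-convergence is convergence of the inverses of the compressions in the weak
operator topology. -/
theorem gConverges_iff_tendsto_inner {a : ℕ → Coeff Ω} {aL : Coeff Ω} {b : ℕ → g0 Ω →L[ℂ] g0 Ω}
    {bL : g0 Ω →L[ℂ] g0 Ω} (hab : ∀ n, compression hd hΩ (a n) * b n = 1)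
    (hba : ∀ n, b n * compression hd hΩ (a n) = 1) (hLab : compression hd hΩ aL * bL = 1)
    (hLba : bL * compression hd hΩ aL = 1) :
    GConverges a aL ↔ ∀ φ ψ, Tendsto (fun n => ⟪ψ, b n φ⟫_ℂ) atTop (𝓝 ⟪ψ, bL φ⟫_ℂ) := by
  have : CompleteSpace (g0 Ω) := (isClosed_g0 hd hΩ).completeSpace_coe
  obtain ⟨e, he⟩ := exists_gradEquiv hd hΩ
  have inv_iff : ∀ {A B : g0 Ω →L[ℂ] g0 Ω}, A * B = 1 → B * A = 1 → ∀ x y, A x = y ↔ x = B y := by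
    intro A B h1 h2 x y
    constructor
    · rintro rfl
      exact (congrArg (fun T : g0 Ω →L[ℂ] g0 Ω => T x) h2).symm
    · rintro rfl
      exact congrArg (fun T : g0 Ω →L[ℂ] g0 Ω => T y) h1
  have hsol := fun a f F hF u => isSolution_iff hd hΩ e he a f F hF u
  constructor
  · intro h φ ψ
    -- With this right-hand side the solutions are exactly `e.symm (b n φ)`.
    let f : StrongDual ℂ (H10 Ω) := innerSL ℂ φ ∘L e.toContinuousLinearMap
    have hf : ∀ v, f v = ⟪φ, e v⟫_ℂ := fun v => rfl
    obtain ⟨u, hu, hus⟩ := h f (fun n => e.symm (b n φ)) fun n => by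
      rw [hsol _ f φ hf, inv_iff (hab n) (hba n), e.apply_symm_apply]
    rw [hsol _ f φ hf, inv_iff hLab hLba] at hus
    have := tendsto_toWeakSpace_iff.1 hu (innerSL ℂ ψ ∘L e.toContinuousLinearMap)
    simpa [hus] using this
  · intro h f u hu
    let F : g0 Ω := (InnerProductSpace.toDual ℂ (g0 Ω)).symm (f ∘L e.symm.toContinuousLinearMap)
    have hF : ∀ v, f v = ⟪F, e v⟫_ℂ := fun v => by
      simp [F, InnerProductSpace.toDual_symm_apply]
    have hun : ∀ n, e (u n) = b n F := fun n =>
      (inv_iff (hab n) (hba n) _ _).1 ((hsol _ f F hF _).1 (hu n))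
    refine ⟨e.symm (bL F), tendsto_toWeakSpace_iff.2 fun l => ?_, ?_⟩
    · let ψ : g0 Ω := (InnerProductSpace.toDual ℂ (g0 Ω)).symm (l ∘L e.symm.toContinuousLinearMap)
      have hl : ∀ v, l v = ⟪ψ, e v⟫_ℂ := fun v => by
        simp [ψ, InnerProductSpace.toDual_symm_apply]
      simpa only [hl, hun, e.apply_symm_apply] using h F ψ
    · rw [hsol _ f F hF, inv_iff hLab hLba, e.apply_symm_apply]

end Classical

end HolG

open HolG
theorem theorem2p4 {d : ℕ} (hd : 0 < d) (Ω : Opens (EuclideanSpace ℝ (Fin d)))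
    (hΩ : Bornology.IsBounded (Ω : Set (EuclideanSpace ℝ (Fin d))))
    (aSeq : ℕ → Coeff Ω) (aLim : Coeff Ω)
    (hn : ∀ n, (0 : ℂ) ∈ resolventSet ℂ (compression hd hΩ (aSeq n)))
    (hLim : (0 : ℂ) ∈ resolventSet ℂ (compression hd hΩ aLim))
    (hbdd : ∃ C : ℝ, ∀ n, ‖Ring.inverse (compression hd hΩ (aSeq n))‖ ≤ C) :
    (HolGConverges (fun n => compression hd hΩ (aSeq n))
        (Function.graph (compression hd hΩ aLim)) → GConverges aSeq aLim) ∧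
    (GConverges aSeq aLim ↔
      ∀ π : ℕ → ℕ, StrictMono π → ∃ κ : ℕ → ℕ, StrictMono κ ∧
        HolGConverges (fun n => compression hd hΩ (aSeq (π (κ n))))
          (Function.graph (compression hd hΩ aLim))) := by
  have : CompleteSpace (g0 Ω) := (isClosed_g0 hd hΩ).completeSpace_coe
  have : Fact ((2 : ℝ≥0∞) ≠ ∞) := ⟨by simp⟩
  -- Supplies the separability of `g0` on which the extraction of subsequences rests.
  have : SecondCountableTopology (L2Vec Ω) :=
    (PiLp.homeomorph 2 (fun _ : Fin d => L2 Ω)).secondCountableTopology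
  have hunit : ∀ {A : g0 Ω →L[ℂ] g0 Ω}, (0 : ℂ) ∈ resolventSet ℂ A → IsUnit A := fun h => by
    simpa using (spectrum.mem_resolventSet_iff.1 h).neg
  obtain ⟨C, hC⟩ := hbdd
  have hC0 : 0 < |C| + 1 := by positivity
  have hb : ∀ n, ‖Ring.inverse (compression hd hΩ (aSeq n))‖ ≤ |C| + 1 := fun n =>
    (hC n).trans (by linarith [le_abs_self C])
  have hab := fun n => Ring.mul_inverse_cancel _ (hunit (hn n))
  have hba := fun n => Ring.inverse_mul_cancel _ (hunit (hn n))
  have hLab := Ring.mul_inverse_cancel _ (hunit hLim)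
  have hLba := Ring.inverse_mul_cancel _ (hunit hLim)
  rw [gConverges_iff_tendsto_inner hd hΩ hab hba hLab hLba]
  refine ⟨fun h => h.tendsto_inner hab hba hLab hC0 hb, fun h π hπ => ?_, fun h φ ψ => ?_⟩
  · exact exists_subseq_holGConverges (fun n => hab (π n)) (fun n => hba (π n)) hLab hLba hC0
      (fun n => hb (π n)) fun φ ψ => (h φ ψ).comp hπ.tendsto_atTop
  · refine tendsto_of_subseq_tendsto fun ns hns => ?_
    -- `ns` merely tends to infinity, so it is first thinned to a strictly increasing sequence.
    obtain ⟨m, hm, hnm⟩ := strictMono_subseq_of_tendsto_atTop hns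
    obtain ⟨κ, -, hκ⟩ := h _ hnm
    exact ⟨m ∘ κ, hκ.tendsto_inner (fun n => hab _) (fun n => hba _) hLab hC0 (fun n => hb _) φ ψ⟩
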